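/- Let $Z$ be a real random variable on a probability space $(\Omega,\mathcal F,\mathbb P)$ taking values in a bounded interval $[a,b]$ with $a<b$, with expectation $\mu=\mathbb E[Z]\neq 0$ and variance $\sigma^2=\mathbb V[Z]$. Let $(Z_i)_{i\ge1}$ be i.i.d. copies of $Z$ on $(\Omega,\mathcal F,\mathbb P)$, and for $m\ge 1$ let $$\overline Z_m=\frac1m\sum_{i=1}^m Z_i,\qquad \overline V_m=\frac1m\sum_{i=1}^m\left(Z_i-\overline Z_m\right)^2 .$$ Let $\epsilon\in(0,1)$, $0<\delta\le 3/4$, $p>1$, $c=\frac{p-1}{p}$, and for $m\ge1$ $$d_m=\delta\, c\, m^{-p},\qquad c_m=\sqrt{\frac{2\overline V_m\log(3/d_m)}{m}}+\frac{3(b-a)\log(3/d_m)}{m}.$$ Define the $\{1,2,\dots\}\cup\{+\infty\}$-valued random variable $M=\min\{m\ge 1 : c_m\le\epsilon|\overline Z_m|\}$ (with $\min\emptyset=+\infty$). Put $\gamma=\left(\sqrt{2+2\sqrt2+2/3}+3\right)^2$, $$\nu=\min\left(\frac{\max(\sigma^2,\epsilon^2\mu^2)}{(b-a)^2},\ \frac{\epsilon^2\mu^2}{(1+\epsilon)^2\max(\sigma^2,\epsilon^2\mu^2)\,\gamma}\right),\qquad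 K=\left\lceil\frac2\nu\left(p\log\left(\frac{2p}{\nu}\right)+\log\left(\frac{3}{c\delta}\right)\right)\right\rceil .$$ Then $M<+\infty$ almost surely, $$\mathbb P(M>K)\le\frac{4\delta}{3},\qquad\text{and}\qquad \mathbb E[M]\le K+\frac{4\delta}{3}.$$ -/

import Mathlib

noncomputable section

namespace RelativeMC

/-- The empirical mean of the first `m` samples. The samples `Z 0, Z 1, …` are the
i.i.d. copies usually written `Z₁, Z₂, …`, so `Z i` is the copy number `i + 1`. -/
def empMean {Ω : Type*} (Z : ℕ → Ω → ℝ) (m : ℕ) (ω : Ω) : ℝ :=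
  (1 / (m : ℝ)) * ∑ i ∈ Finset.range m, Z i ω

/-- The empirical variance of the first `m` samples (normalised by `1 / m`). -/
def empVar {Ω : Type*} (Z : ℕ → Ω → ℝ) (m : ℕ) (ω : Ω) : ℝ :=
  (1 / (m : ℝ)) * ∑ i ∈ Finset.range m, (Z i ω - empMean Z m ω) ^ 2

/-- The half-length `c_m` of the empirical Bernstein confidence interval of level `1 - d_m`
for random variables with values in `[a, b]`. -/
def halfLength {Ω : Type*} (Z : ℕ → Ω → ℝ) (d : ℕ → ℝ) (a b : ℝ) (m : ℕ) (ω : Ω) : ℝ :=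
  Real.sqrt (2 * empVar Z m ω * Real.log (3 / d m) / (m : ℝ))
    + 3 * (b - a) * Real.log (3 / d m) / (m : ℝ)

/-- The random number of samples `M = min {m ≥ 1 : c_m ≤ ε |Z̄_m|}`, with value `⊤` (infinity)
when no such `m` exists. -/
def stopIndex {Ω : Type*} (Z : ℕ → Ω → ℝ) (d : ℕ → ℝ) (a b ε : ℝ) (ω : Ω) : ℕ∞ :=
  sInf ((fun m : ℕ => (m : ℕ∞)) ''
    {m : ℕ | 1 ≤ m ∧ halfLength Z d a b m ω ≤ ε * |empMean Z m ω|})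

/-- The numerical constant `γ = (√(2 + 2√2 + 2/3) + 3)²`. -/
def gam : ℝ := (Real.sqrt (2 + 2 * Real.sqrt 2 + 2 / 3) + 3) ^ 2

/-- The quantity `ν`, as a function of the mean `mean`, the variance `var`, the precision `ε`
and the range `[a, b]`. -/
def nu (mean var ε a b : ℝ) : ℝ :=
  min (max var (ε ^ 2 * mean ^ 2) / (b - a) ^ 2)
    (ε ^ 2 * mean ^ 2 / ((1 + ε) ^ 2 * max var (ε ^ 2 * mean ^ 2) * gam))

/-- The complexity bound `⌈(2/ν)(p log(2p/ν) + log(3/(cδ)))⌉`, where `c = (p - 1)/p`. -/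
def complexityBound (ν p δ : ℝ) : ℕ :=
  ⌈2 / ν * (p * Real.log (2 * p / ν) + Real.log (3 / ((p - 1) / p * δ)))⌉₊

end RelativeMC

end

open ProbabilityTheory MeasureTheory
namespace RelativeMC

/-! Fix `m` and put `L = log(3/d_m)/m`, `R = b - a`. Four one-sided Bernstein events, two for `Z -
μ` and two for `(Z - μ)²`, each have probability at most `d_m/3`. Off them two things hold: the
empirical Bernstein bound `|Z̄_m - μ| ≤ c_m` (`le_empirical_bernstein`) and an upper bound on the
empirical variance, which gives `c_m ≤ ε/(1+ε)·|μ|` as soon as `L ≤ ν` (`half_length_le`). Together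
they force `c_m ≤ ε|Z̄_m|`, so stopping fails at `m` with probability at most `4d_m/3`
(`measureReal_not_stop_le`).

`K` is chosen so that `L ≤ ν` for every `m ≥ K` (`log_le_mul_of_complexityBound_le`), and `c` so
that the `d_m` sum to at most `δ`. Integrating `M ≤ K + ∑_{m ≥ K} 1{M > m}` bounds the expectation,
hence `M` is almost surely finite; the single index `m = K` gives the tail bound. -/

/-! ### Bernstein's inequality -/

theorem exp_le_one_add_add_sq_div {y : ℝ} (hy : y < 3) :
    Real.exp y ≤ 1 + y + y ^ 2 / (2 * (1 - y / 3)) := by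
  let g' : ℝ → ℝ := fun y => 4 + 2 * y - (4 - 2 * y) * Real.exp y
  -- Clearing the denominator `6 - 2y > 0` turns the claim into `0 ≤ g y`; `g` is convex with `g 0 =
  -- g' 0 = 0`.
  let g : ℝ → ℝ := fun y => 6 + 4 * y + y ^ 2 - (6 - 2 * y) * Real.exp y
  have hg : ∀ x, HasDerivAt g (g' x) x := by
    intro x
    have h := ((((hasDerivAt_id x).const_mul 4).const_add 6).add ((hasDerivAt_id x).pow 2)).sub
      ((((hasDerivAt_id x).const_mul 2).const_sub 6).mul (Real.hasDerivAt_exp x))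
    convert! h using 1
    simp [g']; ring
  have hg' : ∀ x, HasDerivAt g' (2 - (2 - 2 * x) * Real.exp x) x := by
    intro x
    have h := (((hasDerivAt_id x).const_mul 2).const_add 4).sub
      ((((hasDerivAt_id x).const_mul 2).const_sub 4).mul (Real.hasDerivAt_exp x))
    convert! h using 1
    simp; ring
  have hmono : Monotone g' := monotone_of_hasDerivAt_nonneg hg' fun x => by
    have h1 : (1 - x) * Real.exp x ≤ 1 := by
      have := Real.add_one_le_exp (-x)
      calc (1 - x) * Real.exp x ≤ Real.exp (-x) * Real.exp x := by gcongr; linarith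
        _ = 1 := by rw [← Real.exp_add]; simp
    simp only [Pi.zero_apply]
    linarith
  have hconv : ConvexOn ℝ Set.univ g := by
    refine MonotoneOn.convexOn_of_deriv convex_univ
      (fun x _ => (hg x).continuousAt.continuousWithinAt)
      (fun x _ => (hg x).differentiableAt.differentiableWithinAt) ?_
    have : deriv g = g' := funext fun x => (hg x).deriv
    rw [this]
    exact hmono.monotoneOn _
  have hmin : g 0 ≤ g y := by
    have hd : HasDerivAt g 0 0 := by simpa [g'] using hg 0
    have : IsMinOn g Set.univ 0 :=
      hconv.isMinOn_of_rightDeriv_eq_zero (by simp) (hd.hasDerivWithinAt.derivWithin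
        (uniqueDiffWithinAt_Ioi 0))
    exact this (Set.mem_univ y)
  have h0 : g 0 = 0 := by simp [g]
  rw [h0] at hmin
  have h3 : 0 < 6 - 2 * y := by linarith
  have e : 1 + y + y ^ 2 / (2 * (1 - y / 3)) = (6 + 4 * y + y ^ 2) / (6 - 2 * y) := by
    have h6 : 2 * (1 - y / 3) = (6 - 2 * y) / 3 := by ring
    rw [h6, eq_div_iff h3.ne', add_mul, div_div_eq_mul_div, div_mul_cancel₀ _ h3.ne']
    ring
  rw [e, le_div_iff₀ h3]
  simp only [g] at hmin
  linarith

theorem mgf_le_exp_of_le {Ω : Type*} [MeasurableSpace Ω] {P : Measure Ω} [IsProbabilityMeasure P]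
    {X : Ω → ℝ} (hX : AEMeasurable X P) {A B v t : ℝ} (hb : ∀ᵐ ω ∂P, X ω ∈ Set.Icc A B)
    (h0 : ∫ ω, X ω ∂P = 0) (hv : ∫ ω, X ω ^ 2 ∂P ≤ v) (ht : 0 ≤ t) (htB : t * B < 3) :
    mgf X P t ≤ Real.exp (v * t ^ 2 / (2 * (1 - t * B / 3))) := by
  have hpos : 0 < 2 * (1 - t * B / 3) := by linarith
  have hL2 : MemLp X 2 P := memLp_of_bounded hb hX.aestronglyMeasurable 2
  have hi1 : Integrable X P := hL2.integrable (by norm_num)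
  have hi2 : Integrable (fun ω => X ω ^ 2) P := hL2.integrable_sq
  have hle : ∀ᵐ ω ∂P, Real.exp (t * X ω) ≤
      1 + t * X ω + t ^ 2 / (2 * (1 - t * B / 3)) * X ω ^ 2 := by
    filter_upwards [hb] with ω hω
    have h1 : t * X ω ≤ t * B := mul_le_mul_of_nonneg_left hω.2 ht
    refine (exp_le_one_add_add_sq_div (h1.trans_lt htB)).trans ?_
    have : (t * X ω) ^ 2 / (2 * (1 - t * X ω / 3)) ≤ (t * X ω) ^ 2 / (2 * (1 - t * B / 3)) := by
      gcongr
    calc _ ≤ 1 + t * X ω + (t * X ω) ^ 2 / (2 * (1 - t * B / 3)) := by gcongr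
      _ = _ := by ring
  calc mgf X P t = ∫ ω, Real.exp (t * X ω) ∂P := rfl
    _ ≤ ∫ ω, (1 + t * X ω + t ^ 2 / (2 * (1 - t * B / 3)) * X ω ^ 2) ∂P :=
        integral_mono_ae (integrable_exp_mul_of_mem_Icc hX hb)
          (((integrable_const _).add (hi1.const_mul t)).add (hi2.const_mul _)) hle
    _ = 1 + t ^ 2 / (2 * (1 - t * B / 3)) * ∫ ω, X ω ^ 2 ∂P := by
        have hi0 : Integrable (fun _ : Ω => (1 : ℝ)) P := integrable_const _
        have hi3 : Integrable (fun ω => 1 + t * X ω) P := hi0.add (hi1.const_mul t)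
        rw [integral_add hi3 (hi2.const_mul _), integral_add hi0 (hi1.const_mul t),
          integral_const_mul, integral_const_mul, h0]
        simp
    _ ≤ 1 + t ^ 2 / (2 * (1 - t * B / 3)) * v := by gcongr
    _ ≤ Real.exp (v * t ^ 2 / (2 * (1 - t * B / 3))) := by
        have := Real.add_one_le_exp (v * t ^ 2 / (2 * (1 - t * B / 3)))
        have e : t ^ 2 / (2 * (1 - t * B / 3)) * v = v * t ^ 2 / (2 * (1 - t * B / 3)) := by ring
        rw [e]; linarith

section iid

variable {Ω : Type*} [MeasurableSpace Ω] {P : Measure Ω} [IsProbabilityMeasure P]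
  {Z : Ω → ℝ} {Zs : ℕ → Ω → ℝ}

theorem chernoff_iid (hZs : ∀ i, Measurable (Zs i))
    (hindep : iIndepFun Zs P) (hident : ∀ i, IdentDistrib (Zs i) Z P P)
    {g : ℝ → ℝ} (hg : Measurable g) {A B v t : ℝ} (hb : ∀ᵐ ω ∂P, g (Z ω) ∈ Set.Icc A B)
    (h0 : ∫ ω, g (Z ω) ∂P = 0) (hv : ∫ ω, g (Z ω) ^ 2 ∂P ≤ v) (ht : 0 ≤ t) (htB : t * B < 3)
    (m : ℕ) (u : ℝ) :
    P.real {ω | m * u ≤ ∑ i ∈ Finset.range m, g (Zs i ω)} ≤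
      Real.exp (m * (v * t ^ 2 / (2 * (1 - t * B / 3)) - t * u)) := by
  let W : ℕ → Ω → ℝ := fun i => g ∘ Zs i
  have hW : ∀ i, Measurable (W i) := fun i => hg.comp (hZs i)
  have hWi : iIndepFun W P := hindep.comp (fun _ => g) (fun _ => hg)
  have hid : ∀ i, IdentDistrib (W i) (g ∘ Z) P P := fun i => (hident i).comp hg
  have hbW : ∀ i, ∀ᵐ ω ∂P, W i ω ∈ Set.Icc A B := fun i =>
    (hid i).symm.ae_mem_snd measurableSet_Icc hb
  have hmgf : ∀ i, mgf (W i) P t ≤ Real.exp (v * t ^ 2 / (2 * (1 - t * B / 3))) := fun i => by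
    refine mgf_le_exp_of_le (hW i).aemeasurable (hbW i) ?_ ?_ ht htB
    · rw [(hid i).integral_eq]; exact h0
    · have := ((hid i).comp (u := fun x : ℝ => x ^ 2) (by fun_prop)).integral_eq
      simp only [Function.comp_apply] at this
      rw [this]; exact hv
  have hint : Integrable (fun ω => Real.exp (t * (∑ i ∈ Finset.range m, W i) ω)) P :=
    hWi.integrable_exp_mul_sum hW fun i _ =>
      integrable_exp_mul_of_mem_Icc (hW i).aemeasurable (hbW i)
  have key := measure_ge_le_exp_mul_mgf (m * u) ht hint
  have hset : {ω | m * u ≤ ∑ i ∈ Finset.range m, g (Zs i ω)} =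
      {ω | m * u ≤ (∑ i ∈ Finset.range m, W i) ω} := by
    ext ω; simp [W]
  rw [hset]
  refine key.trans ?_
  rw [hWi.mgf_sum hW]
  calc Real.exp (-t * (m * u)) * ∏ i ∈ Finset.range m, mgf (W i) P t
      ≤ Real.exp (-t * (m * u)) *
          ∏ i ∈ Finset.range m, Real.exp (v * t ^ 2 / (2 * (1 - t * B / 3))) := by
        gcongr with i _
        · exact fun i _ => mgf_nonneg
        · exact hmgf i
    _ = _ := by
        rw [Finset.prod_const, Finset.card_range, ← Real.exp_nat_mul, ← Real.exp_add]
        congr 1; ring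

/-- Bernstein's inequality for i.i.d. bounded random variables. -/
theorem bernstein_iid (hZs : ∀ i, Measurable (Zs i))
    (hindep : iIndepFun Zs P) (hident : ∀ i, IdentDistrib (Zs i) Z P P)
    {g : ℝ → ℝ} (hg : Measurable g) {A B v : ℝ} (hb : ∀ᵐ ω ∂P, g (Z ω) ∈ Set.Icc A B)
    (h0 : ∫ ω, g (Z ω) ∂P = 0) (hv : ∫ ω, g (Z ω) ^ 2 ∂P ≤ v) (hv0 : 0 ≤ v) (hB : 0 < B)
    {L : ℝ} (hL : 0 < L) (m : ℕ) :
    P.real {ω | m * (Real.sqrt (2 * v * L) + B * L / 3) ≤ ∑ i ∈ Finset.range m, g (Zs i ω)} ≤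
      Real.exp (-(m * L)) := by
  rcases hv0.eq_or_lt with rfl | hv0
  -- For `v = 0` the wanted parameter is `t = 3/B`, just outside the admissible range, so it is
  -- reached as a left limit.
  · have hlim : Filter.Tendsto (fun t : ℝ => Real.exp (-(m * (t * (B * L / 3)))))
        (nhdsWithin (3 / B) (Set.Iio (3 / B))) (nhds (Real.exp (-(m * L)))) := by
      have hc : Continuous fun t : ℝ => Real.exp (-(m * (t * (B * L / 3)))) := by fun_prop
      have h := (hc.tendsto (3 / B)).mono_left (nhdsWithin_le_nhds (s := Set.Iio (3 / B)))
      have e : 3 / B * (B * L / 3) = L := by field_simp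
      rwa [e] at h
    refine ge_of_tendsto hlim ?_
    have hmem : Set.Ioo 0 (3 / B) ∈ nhdsWithin (3 / B) (Set.Iio (3 / B)) :=
      Ioo_mem_nhdsLT (by positivity)
    filter_upwards [hmem] with t ht
    refine (chernoff_iid hZs hindep hident hg hb h0 hv ht.1.le
      ((lt_div_iff₀ hB).1 ht.2) m _).trans (le_of_eq ?_)
    congr 1; simp
  · set u := Real.sqrt (2 * L / v) with hu
    have hu0 : 0 < u := Real.sqrt_pos.2 (by positivity)
    have hu2 : v * u ^ 2 = 2 * L := by
      rw [hu, Real.sq_sqrt (by positivity)]; field_simp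
    have hs : Real.sqrt (2 * v * L) = v * u := by
      rw [show 2 * v * L = (v * u) ^ 2 by linear_combination -v * hu2,
        Real.sqrt_sq (by positivity)]
    have hden : 0 < 1 + B / 3 * u := by positivity
    have hLe : L = v * u ^ 2 / 2 := by linarith
    -- With `u = √(2L/v)` this `t` makes the Chernoff exponent equal to `-mL` exactly.
    refine (chernoff_iid hZs hindep hident hg hb h0 hv (t := u / (1 + B / 3 * u)) (by positivity)
      ?_ m _).trans (le_of_eq ?_)
    · rw [div_mul_eq_mul_div, div_lt_iff₀ hden]; nlinarith
    · have e : 1 - u / (1 + B / 3 * u) * B / 3 = 1 / (1 + B / 3 * u) := by field_simp; ring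
      rw [hs, e, hLe]
      congr 1
      field_simp
      ring

end iid

/-! ### Deterministic consequences of the Bernstein bounds -/

/-- The deterministic step of the empirical Bernstein inequality: Bernstein bounds for the mean
and for the variance yield a deviation bound in terms of the empirical variance `V`. -/
theorem le_empirical_bernstein {R s l D V : ℝ} (hR : 0 < R) (hs : 0 ≤ s) (hl : 0 < l)
    (hD : 0 ≤ D) (hV : 0 ≤ V) (h1 : D ≤ √2 * s * l + R * l ^ 2 / 3)
    (h2 : s ^ 2 ≤ V + D ^ 2 + √2 * R * s * l + R ^ 2 * l ^ 2 / 12) (hsR : s ≤ R / 2) :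
    D ≤ √2 * √V * l + 3 * R * l ^ 2 := by
  -- A failure separates `s` from `√V` by more than `(4/3)√2·R·l`. Since `s ≤ R/2`, this forces `l`
  -- to be small, so `D²` is a small error in `h2`, which then contradicts the gap.
  by_contra! hcon
  set q := √2 with hq
  set w := √V with hw
  have hq0 : 0 < q := by positivity
  have hq2 : q ^ 2 = 2 := Real.sq_sqrt (by norm_num)
  have hw0 : 0 ≤ w := Real.sqrt_nonneg _
  have hw2 : w ^ 2 = V := Real.sq_sqrt hV
  have h3 : q * w + 8 / 3 * R * l < q * s := by
    have : l * (q * w + 8 / 3 * R * l) < l * (q * s) := by nlinarith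
    exact lt_of_mul_lt_mul_left this hl.le
  have h4 : w + 4 / 3 * q * (R * l) < s := by
    have : q * (w + 4 / 3 * q * (R * l)) < q * s := by
      calc _ = q * w + 4 / 3 * q ^ 2 * (R * l) := by ring
        _ = q * w + 8 / 3 * R * l := by rw [hq2]; ring
        _ < _ := h3
    exact lt_of_mul_lt_mul_left this hq0.le
  have hRl : 0 < R * l := by positivity
  have hql : q * l ≤ 3 / 8 := by
    have : R * (q * l) ≤ R * (3 / 8) := by nlinarith
    exact le_of_mul_le_mul_left this hR
  have hl1 : l ≤ 3 / 16 * q := by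
    have : q * l ≤ q * (3 / 16 * q) := by nlinarith
    exact le_of_mul_le_mul_left this hq0
  have hl2 : l ^ 2 ≤ 9 / 128 := by
    have : (q * l) ^ 2 ≤ (3 / 8) ^ 2 := by gcongr
    rw [mul_pow, hq2] at this
    linarith
  have hV' : V ≤ (s - 4 / 3 * q * (R * l)) ^ 2 := by
    rw [← hw2]
    have : w ≤ s - 4 / 3 * q * (R * l) := by linarith
    gcongr
  have hV2 : (s - 4 / 3 * q * (R * l)) ^ 2 =
      s ^ 2 - 8 / 3 * q * s * (R * l) + 32 / 9 * (R * l) ^ 2 := by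
    linear_combination 16 / 9 * (R * l) ^ 2 * hq2
  have hD2 : D ^ 2 ≤ 2 * s ^ 2 * l ^ 2 + 2 / 3 * (q * l) * l * (s * (R * l))
      + (R * l) ^ 2 * l ^ 2 / 9 := by
    calc D ^ 2 ≤ (q * s * l + R * l ^ 2 / 3) ^ 2 := by gcongr
      _ = _ := by linear_combination s ^ 2 * l ^ 2 * hq2
  have t1 : 2 * s ^ 2 * l ^ 2 ≤ 3 / 16 * q * (s * (R * l)) := by
    calc 2 * s ^ 2 * l ^ 2 = 2 * s * (s * l) * l := by ring
      _ ≤ 2 * (R / 2) * (s * l) * (3 / 16 * q) := by gcongr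
      _ = _ := by ring
  have t2 : 2 / 3 * (q * l) * l * (s * (R * l)) ≤ 3 / 64 * q * (s * (R * l)) := by
    calc _ ≤ 2 / 3 * (3 / 8) * (3 / 16 * q) * (s * (R * l)) := by gcongr
      _ = _ := by ring
  have t3 : (R * l) ^ 2 * l ^ 2 / 9 ≤ (R * l) ^ 2 / 128 := by nlinarith [sq_nonneg (R * l)]
  have t4 : (275 / 192 * (q * s)) * (R * l) ≤ (32 / 9 + 1 / 12 + 1 / 128) * (R * l) * (R * l) := by
    nlinarith
  have t5 := le_of_mul_le_mul_right t4 hRl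
  -- `h3` gives `q s > (8/3) R l`, and `275/192 · 8/3 > 32/9 + 1/12 + 1/128`.
  nlinarith [mul_nonneg hq0.le hw0]

theorem gam_pos : 0 < gam := by unfold gam; positivity

/-- The first bound on `L` says `R²L ≤ τ`, so `V ≤ (1 + √2 + 1/3)τ` and `RL ≤ √(τL)`. The
half-length is then at most `√(γτL)`, which is where `γ` comes from; the second bound on `L`
finishes. -/
theorem half_length_le {V L s2 τ R ε μ : ℝ} (hR : 0 < R) (hL : 0 < L) (hε : 0 < ε)
    (hτ : 0 < τ) (hsτ : s2 ≤ τ) (hs : 0 ≤ s2)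
    (hV : V ≤ s2 + √(2 * (R ^ 2 * s2) * L) + R ^ 2 * L / 3)
    (hL1 : L ≤ τ / R ^ 2) (hL2 : L ≤ ε ^ 2 * μ ^ 2 / ((1 + ε) ^ 2 * τ * gam)) :
    √(2 * V * L) + 3 * R * L ≤ ε / (1 + ε) * |μ| := by
  have hRL : R ^ 2 * L ≤ τ := by rwa [le_div_iff₀ (by positivity), mul_comm] at hL1
  have h1 : √(2 * (R ^ 2 * s2) * L) ≤ √2 * τ := by
    calc _ = √(2 * ((R ^ 2 * L) * s2)) := by ring_nf
      _ ≤ √(2 * (τ * τ)) := by gcongr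
      _ = √2 * τ := by rw [Real.sqrt_mul (by norm_num), Real.sqrt_mul_self hτ.le]
  have h2 : √(2 * V * L) ≤ √(2 + 2 * √2 + 2 / 3) * √(τ * L) := by
    rw [← Real.sqrt_mul (by positivity)]
    apply Real.sqrt_le_sqrt
    have : V ≤ (1 + √2 + 1 / 3) * τ := by linarith
    calc 2 * V * L ≤ 2 * ((1 + √2 + 1 / 3) * τ) * L := by gcongr
      _ = _ := by ring
  have h3 : R * L ≤ √(τ * L) := by
    apply Real.le_sqrt_of_sq_le
    nlinarith
  have h4 : √(2 * V * L) + 3 * R * L ≤ √gam * √(τ * L) := by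
    have : √gam = √(2 + 2 * √2 + 2 / 3) + 3 := by
      unfold gam; exact Real.sqrt_sq (by positivity)
    rw [this]; linarith
  refine h4.trans ?_
  rw [← Real.sqrt_mul gam_pos.le]
  refine Real.sqrt_le_iff.2 ⟨by positivity, ?_⟩
  rw [le_div_iff₀ (by have := gam_pos; positivity)] at hL2
  rw [mul_pow, sq_abs, div_pow, div_mul_eq_mul_div, le_div_iff₀ (by positivity)]
  linarith

/-- `(1 + ε)c ≤ ε|μ| ≤ ε(|x| + c)`, and `εc` cancels. -/
theorem le_eps_mul_abs_of_le {c x μ ε : ℝ} (hε : 0 < ε) (hc : c ≤ ε / (1 + ε) * |μ|)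
    (hD : |x - μ| ≤ c) : c ≤ ε * |x| := by
  rw [div_mul_eq_mul_div, le_div_iff₀ (by positivity)] at hc
  have : |μ| ≤ |x| + |x - μ| := by
    have := abs_sub_abs_le_abs_sub μ x
    rw [abs_sub_comm] at this; linarith
  nlinarith

theorem empVar_nonneg {Ω : Type*} (Z : ℕ → Ω → ℝ) (m : ℕ) (ω : Ω) : 0 ≤ empVar Z m ω := by
  unfold empVar
  exact mul_nonneg (by positivity) (Finset.sum_nonneg fun _ _ => sq_nonneg _)

theorem empVar_eq {Ω : Type*} (Z : ℕ → Ω → ℝ) {m : ℕ} (hm : 1 ≤ m) (ω : Ω) (μ : ℝ) :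
    empVar Z m ω = (1 / (m : ℝ)) * ∑ i ∈ Finset.range m, (Z i ω - μ) ^ 2
      - (empMean Z m ω - μ) ^ 2 := by
  have hm0 : (m : ℝ) ≠ 0 := by positivity
  have hS : ∑ i ∈ Finset.range m, Z i ω = m * empMean Z m ω := by
    unfold empMean; field_simp
  unfold empVar
  set e := empMean Z m ω
  have h : ∀ c : ℝ, ∑ i ∈ Finset.range m, (Z i ω - c) ^ 2 =
      ∑ i ∈ Finset.range m, Z i ω ^ 2 - 2 * c * (m * e) + m * c ^ 2 := by
    intro c
    simp only [sub_sq, Finset.sum_add_distrib, Finset.sum_sub_distrib, ← hS, Finset.mul_sum]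
    simp [mul_comm, mul_left_comm]
  rw [h, h]
  field_simp
  ring

/-! ### Failure probability at a fixed sample size -/

section iid

variable {Ω : Type*} [MeasurableSpace Ω] {P : Measure Ω} [IsProbabilityMeasure P]
  {Z : Ω → ℝ} {Zs : ℕ → Ω → ℝ}

/-- For a fixed sample size, the stopping condition fails only on the union of four Bernstein
events. -/
theorem measureReal_not_stop_le (hZ : Measurable Z) {a b : ℝ} (hab : a < b)
    (hZab : ∀ᵐ ω ∂P, Z ω ∈ Set.Icc a b) (hZs : ∀ i, Measurable (Zs i))
    (hindep : iIndepFun Zs P) (hident : ∀ i, IdentDistrib (Zs i) Z P P)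
    (hmean : ∫ ω, Z ω ∂P ≠ 0) {ε : ℝ} (hε : 0 < ε) {d : ℕ → ℝ} {m : ℕ} (hm : 1 ≤ m)
    (hd0 : 0 < d m) (hd3 : d m < 3)
    (hx : Real.log (3 / d m) / m ≤ nu (∫ ω, Z ω ∂P) Var[Z; P] ε a b) :
    P.real {ω | ε * |empMean Zs m ω| < halfLength Zs d a b m ω} ≤ 4 / 3 * d m := by
  set μ := ∫ ω, Z ω ∂P with hμ
  set σ2 := Var[Z; P] with hσ2
  set R := b - a with hR
  set L := Real.log (3 / d m) / m with hL
  have hm0 : (0 : ℝ) < m := by positivity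
  have hR0 : 0 < R := sub_pos.2 hab
  have hL0 : 0 < L := div_pos (Real.log_pos (by rwa [lt_div_iff₀ hd0, one_mul])) hm0
  have hexp : Real.exp (-(m * L)) = d m / 3 := by
    rw [hL, mul_div_cancel₀ _ hm0.ne', Real.exp_neg, Real.exp_log (by positivity), inv_div]
  have hσ0 : 0 ≤ σ2 := variance_nonneg _ _
  have hσR : σ2 ≤ (R / 2) ^ 2 := variance_le_sq_of_bounded hZab hZ.aemeasurable
  have hL2 : MemLp Z 2 P := memLp_of_bounded hZab hZ.aestronglyMeasurable 2
  have hint : Integrable Z P := hL2.integrable (by norm_num)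
  have hμab : μ ∈ Set.Icc a b := by
    constructor
    · have := integral_mono_ae (integrable_const a) hint (hZab.mono fun _ h => h.1)
      simpa using this
    · have := integral_mono_ae hint (integrable_const b) (hZab.mono fun _ h => h.2)
      simpa using this
  have hZR : ∀ᵐ ω ∂P, Z ω - μ ∈ Set.Icc (-R) R := by
    filter_upwards [hZab] with ω hω
    constructor <;> linarith [hω.1, hω.2, hμab.1, hμab.2]
  have hYR : ∀ᵐ ω ∂P, (Z ω - μ) ^ 2 ∈ Set.Icc 0 (R ^ 2) := by
    filter_upwards [hZR] with ω hω
    exact ⟨sq_nonneg _, sq_le_sq' hω.1 hω.2⟩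
  have hvar : ∫ ω, (Z ω - μ) ^ 2 ∂P = σ2 := (variance_eq_integral hZ.aemeasurable).symm
  have hYm : Measurable fun ω => (Z ω - μ) ^ 2 := by fun_prop
  have hYL2 : MemLp (fun ω => (Z ω - μ) ^ 2) 2 P :=
    memLp_of_bounded hYR hYm.aestronglyMeasurable 2
  have hYi : Integrable (fun ω => (Z ω - μ) ^ 2) P := hYL2.integrable (by norm_num)
  -- The variance of `(Z - μ)²` is at most `E(Z - μ)⁴`, and `(Z - μ)² ≤ R²`.
  have hY2 : ∫ ω, ((Z ω - μ) ^ 2 - σ2) ^ 2 ∂P ≤ R ^ 2 * σ2 := by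
    have h1 : Var[fun ω => (Z ω - μ) ^ 2; P] = ∫ ω, ((Z ω - μ) ^ 2 - σ2) ^ 2 ∂P := by
      rw [variance_eq_integral hYm.aemeasurable, hvar]
    rw [← h1]
    refine (variance_le_expectation_sq hYm.aestronglyMeasurable).trans ?_
    rw [← hvar, ← integral_const_mul]
    refine integral_mono_ae hYL2.integrable_sq (hYi.const_mul _) ?_
    filter_upwards [hYR] with ω hω
    simp only [Pi.pow_apply]
    nlinarith [hω.1, hω.2]
  have E1 := bernstein_iid hZs hindep hident (g := fun z => z - μ) (by fun_prop) hZR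
    (by rw [integral_sub hint (integrable_const _)]; simp [hμ]) hvar.le hσ0 hR0 hL0 m
  have E2 := bernstein_iid hZs hindep hident (g := fun z => μ - z) (A := -R) (B := R) (v := σ2)
    (by fun_prop) (by filter_upwards [hZR] with ω hω; constructor <;> linarith [hω.1, hω.2])
    (by rw [integral_sub (integrable_const _) hint]; simp [hμ])
    (by rw [← hvar]; exact le_of_eq (integral_congr_ae (.of_forall fun ω => by ring)))
    hσ0 hR0 hL0 m
  -- Popoviciu's `σ² ≤ (R/2)²` provides the upper bound `B` here, hence the `1/12` in
  -- `le_empirical_bernstein`.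
  have E3 := bernstein_iid hZs hindep hident (g := fun z => σ2 - (z - μ) ^ 2)
    (A := σ2 - R ^ 2) (B := (R / 2) ^ 2) (v := R ^ 2 * σ2) (by fun_prop)
    (by filter_upwards [hYR] with ω hω; constructor <;> linarith [hω.1, hω.2])
    (by rw [integral_sub (integrable_const _) hYi, hvar]; simp)
    (le_of_eq_of_le (integral_congr_ae (.of_forall fun ω => by ring)) hY2)
    (by positivity) (by positivity) hL0 m
  have E4 := bernstein_iid hZs hindep hident (g := fun z => (z - μ) ^ 2 - σ2)
    (A := -σ2) (B := R ^ 2) (v := R ^ 2 * σ2) (by fun_prop)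
    (by filter_upwards [hYR] with ω hω; constructor <;> linarith [hω.1, hω.2])
    (by rw [integral_sub hYi (integrable_const _), hvar]; simp) hY2
    (by positivity) (by positivity) hL0 m
  rw [hexp] at E1 E2 E3 E4
  set S1 := {ω | m * (√(2 * σ2 * L) + R * L / 3) ≤ ∑ i ∈ Finset.range m, (Zs i ω - μ)}
  set S2 := {ω | m * (√(2 * σ2 * L) + R * L / 3) ≤ ∑ i ∈ Finset.range m, (μ - Zs i ω)}
  set S3 := {ω | m * (√(2 * (R ^ 2 * σ2) * L) + (R / 2) ^ 2 * L / 3) ≤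
    ∑ i ∈ Finset.range m, (σ2 - (Zs i ω - μ) ^ 2)}
  set S4 := {ω | m * (√(2 * (R ^ 2 * σ2) * L) + R ^ 2 * L / 3) ≤
    ∑ i ∈ Finset.range m, ((Zs i ω - μ) ^ 2 - σ2)}
  have hsub : {ω | ε * |empMean Zs m ω| < halfLength Zs d a b m ω} ⊆ (S1 ∪ S2) ∪ (S3 ∪ S4) := by
    intro ω hω
    by_contra hnot
    simp only [S1, S2, S3, S4, Set.mem_union, Set.mem_ofPred_eq, not_or, not_le] at hnot hω
    obtain ⟨⟨n1, n2⟩, n3, n4⟩ := hnot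
    refine absurd hω (not_lt.2 ?_)
    set e := empMean Zs m ω with he
    set Q := (1 / (m : ℝ)) * ∑ i ∈ Finset.range m, (Zs i ω - μ) ^ 2 with hQ
    have hVeq : empVar Zs m ω = Q - (e - μ) ^ 2 := empVar_eq Zs hm ω μ
    have hV0 := empVar_nonneg Zs m ω
    set V := empVar Zs m ω with hV
    have hSe : ∑ i ∈ Finset.range m, Zs i ω = m * e := by
      rw [he, empMean]; field_simp
    have hSQ : ∑ i ∈ Finset.range m, (Zs i ω - μ) ^ 2 = m * Q := by
      rw [hQ]; field_simp
    rw [Finset.sum_sub_distrib, hSe, Finset.sum_const, Finset.card_range, nsmul_eq_mul,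
      ← mul_sub] at n1 n2
    rw [Finset.sum_sub_distrib, hSQ, Finset.sum_const, Finset.card_range, nsmul_eq_mul,
      ← mul_sub] at n3 n4
    have k1 := lt_of_mul_lt_mul_left n1 hm0.le
    have k2 := lt_of_mul_lt_mul_left n2 hm0.le
    have k3 := lt_of_mul_lt_mul_left n3 hm0.le
    have k4 := lt_of_mul_lt_mul_left n4 hm0.le
    have hlen : halfLength Zs d a b m ω = √(2 * V * L) + 3 * R * L := by
      rw [halfLength, hL, mul_div_assoc, mul_div_assoc]
    rw [hlen]
    have hD : |e - μ| ≤ √(2 * V * L) + 3 * R * L := by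
      have q1 : √(2 * σ2 * L) = √2 * √σ2 * √L := by
        rw [Real.sqrt_mul (by positivity), Real.sqrt_mul (by positivity)]
      have q2 : √(2 * V * L) = √2 * √V * √L := by
        rw [Real.sqrt_mul (by positivity), Real.sqrt_mul (by positivity)]
      have q3 : √(2 * (R ^ 2 * σ2) * L) = √2 * R * √σ2 * √L := by
        rw [Real.sqrt_mul (by positivity), Real.sqrt_mul (by positivity),
          Real.sqrt_mul (by positivity), Real.sqrt_sq hR0.le]
        ring
      have qL : √L ^ 2 = L := Real.sq_sqrt hL0.le
      have qσ : √σ2 ^ 2 = σ2 := Real.sq_sqrt hσ0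
      have := le_empirical_bernstein (R := R) (s := √σ2) (l := √L) (D := |e - μ|) (V := V) hR0
        (Real.sqrt_nonneg _) (Real.sqrt_pos.2 hL0) (abs_nonneg _) hV0
        (by rw [← q1, qL, abs_le]; constructor <;> linarith)
        (by rw [sq_abs, qL, qσ, ← q3]; linarith)
        (Real.sqrt_le_iff.2 ⟨by positivity, hσR⟩)
      rwa [← q2, qL] at this
    refine le_eps_mul_abs_of_le hε ?_ hD
    have hτ : 0 < max σ2 (ε ^ 2 * μ ^ 2) := lt_max_of_lt_right (by positivity)
    exact half_length_le hR0 hL0 hε hτ (le_max_left _ _) hσ0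
      (by linarith [sq_nonneg (e - μ)]) (hx.trans (min_le_left _ _)) (hx.trans (min_le_right _ _))
  calc _ ≤ P.real ((S1 ∪ S2) ∪ (S3 ∪ S4)) := measureReal_mono hsub
    _ ≤ (P.real S1 + P.real S2) + (P.real S3 + P.real S4) :=
        (measureReal_union_le _ _).trans
          (add_le_add (measureReal_union_le _ _) (measureReal_union_le _ _))
    _ ≤ (d m / 3 + d m / 3) + (d m / 3 + d m / 3) := by gcongr
    _ = 4 / 3 * d m := by ring

end iid

/-! ### Summing the `d_m` and choosing `K` -/

theorem sum_rpow_neg_le {p : ℝ} (hp : 1 < p) (n : ℕ) :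
    ∑ i ∈ Finset.range (n + 1), ((i + 1 : ℕ) : ℝ) ^ (-p) ≤
      1 + (1 - ((n + 1 : ℕ) : ℝ) ^ (1 - p)) / (p - 1) := by
  have hp1 : 0 < p - 1 := by linarith
  induction n with
  | zero => simp
  | succ n ih =>
    rw [Finset.sum_range_succ]
    set x : ℝ := ((n + 1 : ℕ) : ℝ) with hx
    have hx0 : 0 < x := by positivity
    have hy : ((n + 1 + 1 : ℕ) : ℝ) = x + 1 := by push_cast [hx]; ring
    rw [hy]
    have hy0 : 0 < x + 1 := by positivity
    have hb : 1 + p * (1 / x) ≤ (1 + 1 / x) ^ p :=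
      one_add_mul_self_le_rpow_one_add (by have : 0 < 1 / x := by positivity
                                           linarith) hp.le
    have e : 1 + 1 / x = (x + 1) / x := by field_simp
    rw [e, Real.div_rpow hy0.le hx0.le] at hb
    have hxp : 0 < x ^ p := by positivity
    have hyp : 0 < (x + 1) ^ p := by positivity
    -- Bernoulli's inequality replaces the comparison with `∫ t^(-p) dt`; the right side telescopes.
    have key : (x + 1) ^ (-p) * (p - 1) ≤ x ^ (1 - p) - (x + 1) ^ (1 - p) := by
      rw [Real.rpow_sub hx0, Real.rpow_sub hy0, Real.rpow_neg hy0.le, Real.rpow_one, Real.rpow_one]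
      have h1 : (x + p) * x ^ p ≤ x * (x + 1) ^ p := by
        have h2 : (1 + p * (1 / x)) * (x * x ^ p) ≤ (x + 1) ^ p / x ^ p * (x * x ^ p) := by gcongr
        have h3 : (1 + p * (1 / x)) * (x * x ^ p) = (x + p) * x ^ p := by field_simp
        have h4 : (x + 1) ^ p / x ^ p * (x * x ^ p) = x * (x + 1) ^ p := by field_simp
        linarith
      have h2 : (x + p) / (x + 1) ^ p ≤ x / x ^ p := by
        rwa [div_le_div_iff₀ hyp hxp]
      have h3 : ((x + 1) ^ p)⁻¹ * (p - 1) + (x + 1) / (x + 1) ^ p = (x + p) / (x + 1) ^ p := by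
        field_simp; ring
      linarith
    have k2 : (x + 1) ^ (-p) ≤ (x ^ (1 - p) - (x + 1) ^ (1 - p)) / (p - 1) := by
      rwa [le_div_iff₀ hp1]
    calc _ ≤ 1 + (1 - x ^ (1 - p)) / (p - 1) +
          (x ^ (1 - p) - (x + 1) ^ (1 - p)) / (p - 1) := add_le_add ih k2
      _ = _ := by ring

theorem mul_sum_rpow_neg_le_one {p : ℝ} (hp : 1 < p) (n : ℕ) :
    (p - 1) / p * ∑ i ∈ Finset.range n, ((i + 1 : ℕ) : ℝ) ^ (-p) ≤ 1 := by
  have hp1 : 0 < p - 1 := by linarith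
  have h1 : ∑ i ∈ Finset.range n, ((i + 1 : ℕ) : ℝ) ^ (-p) ≤
      ∑ i ∈ Finset.range (n + 1), ((i + 1 : ℕ) : ℝ) ^ (-p) :=
    Finset.sum_le_sum_of_subset_of_nonneg (Finset.range_mono n.le_succ)
      fun _ _ _ => by positivity
  have h2 : (1 - ((n + 1 : ℕ) : ℝ) ^ (1 - p)) / (p - 1) ≤ 1 / (p - 1) := by
    have : 0 ≤ ((n + 1 : ℕ) : ℝ) ^ (1 - p) := by positivity
    gcongr; linarith
  calc _ ≤ (p - 1) / p * (1 + 1 / (p - 1)) := by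
        gcongr; linarith [sum_rpow_neg_le hp n]
    _ = 1 := by field_simp; ring

theorem sum_range_add_rpow_neg_le {p : ℝ} (hp : 1 < p) {K : ℕ} (hK : 1 ≤ K) (n : ℕ) :
    (p - 1) / p * ∑ j ∈ Finset.range n, ((K + j : ℕ) : ℝ) ^ (-p) ≤ 1 := by
  refine le_trans ?_ (mul_sum_rpow_neg_le_one hp n)
  have hp1 : 0 < p - 1 := by linarith
  refine mul_le_mul_of_nonneg_left (Finset.sum_le_sum fun j _ => ?_) (by positivity)
  refine Real.rpow_le_rpow_of_nonpos (by positivity) ?_ (by linarith)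
  exact_mod_cast (by omega : j + 1 ≤ K + j)

theorem nu_pos {mean var ε a b : ℝ} (hmean : mean ≠ 0) (hε : 0 < ε) (hab : a < b) :
    0 < nu mean var ε a b := by
  have hτ : 0 < max var (ε ^ 2 * mean ^ 2) := lt_max_of_lt_right (by positivity)
  have := gam_pos
  have : 0 < b - a := sub_pos.2 hab
  exact lt_min (by positivity) (by positivity)

theorem nu_le_one {mean var ε a b : ℝ} (hε : 0 < ε) (hmean : mean ≠ 0) :
    nu mean var ε a b ≤ 1 := by
  refine (min_le_right _ _).trans ?_
  have hτ : 0 < max var (ε ^ 2 * mean ^ 2) := lt_max_of_lt_right (by positivity)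
  have hg : 1 ≤ gam := by
    have := Real.sqrt_nonneg (2 + 2 * √2 + 2 / 3)
    unfold gam; nlinarith
  have h1 : 1 ≤ (1 + ε) ^ 2 := by nlinarith
  rw [div_le_one (by positivity)]
  calc ε ^ 2 * mean ^ 2 ≤ max var (ε ^ 2 * mean ^ 2) := le_max_right _ _
    _ = 1 * max var (ε ^ 2 * mean ^ 2) * 1 := by ring
    _ ≤ (1 + ε) ^ 2 * max var (ε ^ 2 * mean ^ 2) * gam := by gcongr

/-- Applying `log y ≤ y - 1` at `y = mν/(2p)` absorbs `p log m` into `mν/2 + p log(2p/ν)`. The other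
`mν/2` covers the remaining terms because `m ≥ K`; hence the factor 2 in `K`. -/
theorem log_le_mul_of_complexityBound_le {ν p δ : ℝ} (hν : 0 < ν) (hp : 1 < p) (hδ : 0 < δ)
    {m : ℕ} (hm : 1 ≤ m) (hK : complexityBound ν p δ ≤ m) :
    Real.log (3 / (δ * ((p - 1) / p) * (m : ℝ) ^ (-p))) / m ≤ ν := by
  have hm0 : (0 : ℝ) < m := by positivity
  have hp0 : 0 < p := by linarith
  have hp1 : 0 < p - 1 := by linarith
  have hK' : 2 / ν * (p * Real.log (2 * p / ν) + Real.log (3 / ((p - 1) / p * δ))) ≤ m :=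
    (Nat.le_ceil _).trans (by exact_mod_cast hK)
  rw [div_mul_eq_mul_div, div_le_iff₀ hν] at hK'
  have e : 3 / (δ * ((p - 1) / p) * (m : ℝ) ^ (-p)) = 3 / ((p - 1) / p * δ) * (m : ℝ) ^ p := by
    rw [Real.rpow_neg hm0.le]; field_simp
  rw [e, Real.log_mul (by positivity) (by positivity), Real.log_rpow hm0, div_le_iff₀ hm0]
  have hlog : Real.log m ≤ m * ν / (2 * p) + Real.log (2 * p / ν) := by
    have h1 := Real.log_le_sub_one_of_pos (x := m * ν / (2 * p)) (by positivity)
    have h2 : Real.log m = Real.log (m * ν / (2 * p)) + Real.log (2 * p / ν) := by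
      rw [← Real.log_mul (by positivity) (by positivity)]; congr 1; field_simp
    linarith
  have h3 : p * Real.log m ≤ m * ν / 2 + p * Real.log (2 * p / ν) := by
    calc p * Real.log m ≤ p * (m * ν / (2 * p) + Real.log (2 * p / ν)) := by gcongr
      _ = _ := by field_simp
  linarith

theorem one_le_complexityBound {ν p δ : ℝ} (hν : 0 < ν) (hν1 : ν ≤ 1) (hp : 1 < p)
    (hδ : 0 < δ) (hδ1 : δ ≤ 1) : 1 ≤ complexityBound ν p δ := by
  have hp1 : 0 < p - 1 := by linarith
  have h1 : 0 < Real.log (2 * p / ν) := Real.log_pos (by rw [lt_div_iff₀ hν]; linarith)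
  have h2 : 0 < Real.log (3 / ((p - 1) / p * δ)) := by
    have hc : (p - 1) / p ≤ 1 := by rw [div_le_one (by linarith)]; linarith
    have : (p - 1) / p * δ ≤ 1 := mul_le_one₀ hc hδ.le hδ1
    exact Real.log_pos (by rw [lt_div_iff₀ (by positivity)]; linarith)
  exact Nat.one_le_ceil_iff.2 (by positivity)

/-! ### The stopping index and its expectation -/

section stopping

variable {Ω : Type*} {Zs : ℕ → Ω → ℝ} {d : ℕ → ℝ} {a b ε : ℝ}

theorem lt_halfLength_of_lt_stopIndex {m : ℕ} (hm : 1 ≤ m) {ω : Ω}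
    (h : (m : ℕ∞) < stopIndex Zs d a b ε ω) :
    ε * |empMean Zs m ω| < halfLength Zs d a b m ω := by
  by_contra! hcon
  exact absurd h (not_lt.2 (sInf_le ⟨m, ⟨hm, hcon⟩, rfl⟩))

theorem enat_le_add_tsum_indicator (N : ℕ∞) (K : ℕ) :
    (N : ENNReal) ≤ K + ∑' j : ℕ, if ((K + j : ℕ) : ℕ∞) < N then 1 else 0 := by
  induction N using ENat.recTopCoe with
  | top => simp
  | coe n =>
    have h := ENNReal.sum_le_tsum (f := fun j : ℕ => if ((K + j : ℕ) : ℕ∞) < (n : ℕ∞) then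
      (1 : ENNReal) else 0) (Finset.range (n - K))
    have e : ∑ j ∈ Finset.range (n - K), (if ((K + j : ℕ) : ℕ∞) < (n : ℕ∞) then
        (1 : ENNReal) else 0) = ((n - K : ℕ) : ENNReal) := by
      rw [Finset.sum_congr rfl (g := fun _ => (1 : ENNReal))]
      · simp
      · intro j hj
        rw [Finset.mem_range] at hj
        rw [if_pos (Nat.cast_lt.2 (by omega))]
    rw [e] at h
    refine le_trans ?_ (add_le_add_right h _)
    have : n ≤ K + (n - K) := by omega
    simpa using (by exact_mod_cast this : (n : ENNReal) ≤ ((K + (n - K) : ℕ) : ENNReal))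

variable [MeasurableSpace Ω]

theorem measurableSet_not_stop (hZs : ∀ i, Measurable (Zs i)) (m : ℕ) :
    MeasurableSet {ω | ε * |empMean Zs m ω| < halfLength Zs d a b m ω} := by
  have h1 : Measurable fun ω => empMean Zs m ω := by unfold empMean; fun_prop
  have h2 : Measurable fun ω => empVar Zs m ω := by unfold empVar; fun_prop
  have h3 : Measurable fun ω => halfLength Zs d a b m ω := by unfold halfLength; fun_prop
  exact measurableSet_lt (by fun_prop) h3

end stopping
end RelativeMC

open RelativeMC in
theorem mainTheorem2 {Ω : Type*} [MeasurableSpace Ω]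
    (P : MeasureTheory.Measure Ω) [MeasureTheory.IsProbabilityMeasure P]
    (Z : Ω → ℝ) (hZ : Measurable Z)
    (a b : ℝ) (hab : a < b) (hZab : ∀ᵐ ω ∂P, Z ω ∈ Set.Icc a b)
    (Zs : ℕ → Ω → ℝ) (hZs : ∀ i, Measurable (Zs i))
    (hindep : ProbabilityTheory.iIndepFun Zs P)
    (hident : ∀ i, ProbabilityTheory.IdentDistrib (Zs i) Z P P)
    (hmean : ∫ ω, Z ω ∂P ≠ 0)
    (ε δ p : ℝ) (hε0 : 0 < ε) (hε1 : ε < 1) (hδ0 : 0 < δ) (hδ1 : δ ≤ 3 / 4) (hp : 1 < p)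
    (d : ℕ → ℝ) (hd : ∀ m : ℕ, 1 ≤ m → d m = δ * ((p - 1) / p) * (m : ℝ) ^ (-p))
    (ν : ℝ) (hν : ν = RelativeMC.nu (∫ ω, Z ω ∂P) (ProbabilityTheory.variance Z P) ε a b) :
    (∀ᵐ ω ∂P, RelativeMC.stopIndex Zs d a b ε ω < ⊤) ∧
    P {ω | (RelativeMC.complexityBound ν p δ : ℕ∞) < RelativeMC.stopIndex Zs d a b ε ω}
      ≤ ENNReal.ofReal (4 * δ / 3) ∧
    ∫⁻ ω, (RelativeMC.stopIndex Zs d a b ε ω : ENNReal) ∂P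
      ≤ (RelativeMC.complexityBound ν p δ : ENNReal) + ENNReal.ofReal (4 * δ / 3) := by
  have hν0 : 0 < ν := hν ▸ nu_pos hmean hε0 hab
  have hν1 : ν ≤ 1 := hν ▸ nu_le_one hε0 hmean
  have hp1 : 0 < p - 1 := by linarith
  have hK : 1 ≤ complexityBound ν p δ := one_le_complexityBound hν0 hν1 hp hδ0 (by linarith)
  set K := complexityBound ν p δ with hKdef
  let bad : ℕ → Set Ω := fun m => {ω | ε * |empMean Zs m ω| < halfLength Zs d a b m ω}
  have hbadm : ∀ m, MeasurableSet (bad m) := measurableSet_not_stop hZs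
  have hdpos : ∀ m, 1 ≤ m → 0 < d m := fun m hm => by
    have : (0 : ℝ) < m := by positivity
    rw [hd m hm]; positivity
  have hd1 : ∀ m, 1 ≤ m → d m ≤ δ := fun m hm => by
    have h1 : (p - 1) / p ≤ 1 := by rw [div_le_one (by linarith)]; linarith
    have h2 : (m : ℝ) ^ (-p) ≤ 1 :=
      Real.rpow_le_one_of_one_le_of_nonpos (by exact_mod_cast hm) (by linarith)
    rw [hd m hm]
    calc δ * ((p - 1) / p) * (m : ℝ) ^ (-p) ≤ δ * 1 * 1 := by gcongr
      _ = δ := by ring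
  have hbad : ∀ m, K ≤ m → P (bad m) ≤ ENNReal.ofReal (4 / 3 * d m) := fun m hm => by
    have hm1 : 1 ≤ m := hK.trans hm
    rw [ENNReal.le_ofReal_iff_toReal_le (measure_ne_top _ _) (by have := hdpos m hm1; positivity)]
    refine measureReal_not_stop_le hZ hab hZab hZs hindep hident hmean hε0 hm1 (hdpos m hm1)
      (by linarith [hd1 m hm1]) ?_
    rw [← hν, hd m hm1]
    exact log_le_mul_of_complexityBound_le hν0 hp hδ0 hm1 hm
  have hsub : ∀ m, K ≤ m → {ω | (m : ℕ∞) < stopIndex Zs d a b ε ω} ⊆ bad m :=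
    fun m hm ω hω => lt_halfLength_of_lt_stopIndex (hK.trans hm) hω
  -- A measurable majorant of `stopIndex`, so measurability is needed only for the sets `bad m`.
  let G : Ω → ENNReal := fun ω => K + ∑' j : ℕ, (bad (K + j)).indicator 1 ω
  have hGm : Measurable G := by
    have hj : ∀ j, Measurable ((bad (K + j)).indicator (1 : Ω → ENNReal)) :=
      fun j => measurable_one.indicator (hbadm _)
    fun_prop
  have hle : ∀ ω, (stopIndex Zs d a b ε ω : ENNReal) ≤ G ω := fun ω => by
    refine (enat_le_add_tsum_indicator _ K).trans ?_
    refine add_le_add_right (ENNReal.tsum_le_tsum fun j => ?_) _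
    split_ifs with h
    · rw [Set.indicator_of_mem (hsub _ (Nat.le_add_right _ _) h)]; simp
    · exact zero_le
  have hG : ∫⁻ ω, G ω ∂P ≤ K + ENNReal.ofReal (4 * δ / 3) := by
    rw [lintegral_add_left measurable_const, lintegral_const, measure_univ, mul_one,
      lintegral_tsum fun j => (measurable_one.indicator (hbadm _)).aemeasurable]
    refine add_le_add_right (ENNReal.tsum_le_of_sum_range_le fun n => ?_) _
    calc ∑ j ∈ Finset.range n, ∫⁻ ω, (bad (K + j)).indicator 1 ω ∂P
        ≤ ∑ j ∈ Finset.range n, ENNReal.ofReal (4 / 3 * d (K + j)) := by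
          gcongr with j _
          rw [lintegral_indicator_one (hbadm _)]
          exact hbad _ (Nat.le_add_right _ _)
      _ = ENNReal.ofReal (∑ j ∈ Finset.range n, 4 / 3 * d (K + j)) :=
          (ENNReal.ofReal_sum_of_nonneg fun j _ => by
            have := hdpos (K + j) (by omega); positivity).symm
      _ ≤ ENNReal.ofReal (4 * δ / 3) := by
          apply ENNReal.ofReal_le_ofReal
          calc ∑ j ∈ Finset.range n, 4 / 3 * d (K + j)
              = 4 * δ / 3 * ((p - 1) / p * ∑ j ∈ Finset.range n, ((K + j : ℕ) : ℝ) ^ (-p)) := by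
                rw [Finset.mul_sum, Finset.mul_sum]
                refine Finset.sum_congr rfl fun j _ => ?_
                rw [hd (K + j) (by omega)]; ring
            _ ≤ 4 * δ / 3 * 1 := by gcongr; exact sum_range_add_rpow_neg_le hp hK n
            _ = 4 * δ / 3 := mul_one _
  refine ⟨?_, ?_, (lintegral_mono hle).trans hG⟩
  · have hfin : ∫⁻ ω, G ω ∂P ≠ ⊤ := ne_top_of_le_ne_top (by simp) hG
    filter_upwards [ae_lt_top hGm hfin] with ω hω
    exact ENat.toENNReal_lt_top.1 ((hle ω).trans_lt hω)
  · refine (measure_mono (hsub K le_rfl)).trans ((hbad K le_rfl).trans ?_)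
    exact ENNReal.ofReal_le_ofReal (by linarith [hd1 K hK])
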